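/- Let $n\ge 2$ and identify $\mathbb C^n$ with $\mathbb R^{2n}$ in the standard way. A compact set $K\subset\mathbb R^{2n}$ is a star body if the origin is an interior point of $K$, every straight line through the origin meets the boundary of $K$ in exactly two points, and the Minkowski functional $\|x\|_K=\min\{a\ge 0: x\in aK\}$ is continuous on $\mathbb R^{2n}$. It is a complex star body if, in addition, $\|e^{i\theta}x\|_K=\|x\|_K$ for all $\theta\in[0,2\pi]$ and $x\in\mathbb C^n$, and it is origin symmetric if $K=-K$. For $\xi\in\mathbb C^n$ with $|\xi|=1$ let $H_\xi=\{z\in\mathbb C^n:\sum_{k=1}^n z_k\overline{\xi_k}=0\}$, a real subspace of dimension $2n-2$, let $H_\xi^\perp$ be its two-dimensional orthogonal complement in $\mathbb R^{2n}$, and let $|\cdot|$ denote volume in the appropriate dimension. For origin symmetric complex star bodies $M,K$ in $\mathbb R^{2n}$ we say that $M$ is the complex intersection body of $K$, and write $M=I_c(K)$, if $|M\cap H_\xi^\perp|=|K\cap H_\xi|$ for every unit vector $\xi$. Let $K,L$ be origin symmetric complex star bodies in $\mathbb R^{2n}$. (1) If the complex intersection bodies of $K$ and $L$ coincide, that is,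 if some $M$ satisfies $M=I_c(K)$ and $M=I_c(L)$, then $K=L$. (2) If $|K\cap H_\xi|=|L\cap H_\xi|$ for every unit vector $\xi\in\mathbb C^n$, then $K=L$. That is, an origin symmetric complex star body is uniquely determined by the volumes of its central complex hyperplane sections. -/

import Mathlib

open MeasureTheory

/-- A star body in a real normed space: a compact set having the origin in its interior, whose
boundary is met in exactly two points by every line through the origin, and whose Minkowski
functional is continuous. For such a set `gauge K x = min {a ≥ 0 : x ∈ a K}`. -/
structure IsStarBody {E : Type*} [NormedAddCommGroup E] [NormedSpace ℝ E] (K : Set E) : Prop where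
  isCompact : IsCompact K
  zero_mem_interior : (0 : E) ∈ interior K
  line_inter_frontier : ∀ x : E, x ≠ 0 →
    (((Submodule.span ℝ {x} : Submodule ℝ E) : Set E) ∩ frontier K).encard = 2
  continuous_gauge : Continuous (gauge K)

/-- An origin symmetric complex star body in `ℂⁿ = ℝ²ⁿ`: the coordinatewise rotation `R_θ` of `ℝ²ⁿ`
is multiplication by `exp (iθ)` on `ℂⁿ`. -/
structure IsSymmComplexStarBody {n : ℕ} (K : Set (EuclideanSpace ℂ (Fin n))) : Prop where
  isStarBody : IsStarBody K
  gauge_rotation : ∀ θ ∈ Set.Icc (0 : ℝ) (2 * Real.pi), ∀ x : EuclideanSpace ℂ (Fin n),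
    gauge K (Complex.exp (θ * Complex.I) • x) = gauge K x
  symmetric : ∀ x ∈ K, -x ∈ K

/-- The complex hyperplane `H_ξ = {z : ∑ₖ zₖ conj(ξₖ) = 0}` of `ℂⁿ`, as a subspace of `ℝ²ⁿ`. -/
noncomputable def complexHyperplane {n : ℕ} (ξ : EuclideanSpace ℂ (Fin n)) :
    Submodule ℝ (EuclideanSpace ℂ (Fin n)) :=
  ((Submodule.span ℂ {ξ})ᗮ).restrictScalars ℝ

/-- The volume `|K ∩ S|` of the section of `K` by a real subspace `S` of `ℂⁿ = ℝ²ⁿ`: the Lebesgue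
measure of the Euclidean space `S` (in the dimension of `S`) applied to the points of `S` in `K`. -/
noncomputable def sectionVolume {n : ℕ} (K : Set (EuclideanSpace ℂ (Fin n)))
    (S : Submodule ℝ (EuclideanSpace ℂ (Fin n))) : ENNReal :=
  volume {z : S | (z : EuclideanSpace ℂ (Fin n)) ∈ K}

/-- `M = I_c(K)`: `M` is the complex intersection body of `K`. The orthogonal complement of `H_ξ` is
the real one in `ℝ²ⁿ`, a plane. -/
structure IsComplexIntersectionBodyOf {n : ℕ} (M K : Set (EuclideanSpace ℂ (Fin n))) : Prop where
  left : IsSymmComplexStarBody M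
  right : IsSymmComplexStarBody K
  volume_eq : ∀ ξ : EuclideanSpace ℂ (Fin n), ‖ξ‖ = 1 →
    sectionVolume M (complexHyperplane ξ)ᗮ = sectionVolume K (complexHyperplane ξ)

open Set Filter Topology
open scoped Pointwise

/-! Put `D = 1_K - 1_L`; its integral over every complex hyperplane `H_ξ` vanishes. Injectivity of
this complex Radon transform is obtained by testing against Gaussians. Pair `D(x)` with the Gaussian
character `φ(ξ) = exp (-|ξ|² + i s ⟨a, ξ⟩)` through the kernel `m exp (-m |⟨x, ξ⟩|²)`, which for
large `m` concentrates on `x ⊥ ξ`. Integrating in `x` before `ξ`, the limit is an integral of `π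
|ξ|⁻² φ(ξ) ∫_{H_ξ} D`, hence zero. In the other order it is an integral of `π |x|⁻² D(x) ∫_{H_x} φ`,
and the inner integral is `π^(n-1) exp (-s² |P_x a|² / 4)`, with `P_x` the projection onto `H_x`.
Fubini thus gives `integral_mul_kernel_eq_zero`. For `|a| = 1`, `|P_x a|²` is the squared sine of
the angle between `x` and the complex line of `a`, so as `s → ∞` the kernel singles out that line.
If `gauge K a < gauge L a`, then by continuity and complex homogeneity `D ≥ 0` on a cone around the
line and `D = 1` on an open set inside it; the rest is exponentially smaller, contradicting the
vanishing integral (`gauge_le_of_norm_eq_one`). By symmetry the gauges agree on the unit sphere,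
hence everywhere. The statement on intersection bodies reduces to this, since `M` gives both section
volumes the same value. -/

theorem IsPreconnected.exists_mem_frontier {X : Type*} [TopologicalSpace X] {s u : Set X}
    (hs : IsPreconnected s) {a b : X} (ha : a ∈ s) (hau : a ∈ u) (hb : b ∈ s) (hbu : b ∉ u) :
    ∃ c ∈ s, c ∈ frontier u := by
  by_contra! h
  have hcover : s ⊆ interior u ∪ (closure u)ᶜ := fun x hx => by
    by_cases hxi : x ∈ interior u
    · exact Or.inl hxi
    · exact Or.inr fun hxc => h x hx ⟨hxc, hxi⟩
  have hdisj : Disjoint (interior u) (closure u)ᶜ :=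
    disjoint_compl_right.mono_left (interior_subset.trans subset_closure)
  rcases hs.subset_or_subset isOpen_interior isClosed_closure.isOpen_compl hdisj hcover with h' | h'
  · exact hbu (interior_subset (h' hb))
  · exact h' ha (subset_closure hau)

/-! ### Star bodies: radial structure, gauge, null boundary -/

namespace IsStarBody

variable {E : Type*} [NormedAddCommGroup E] [NormedSpace ℝ E] {K : Set E}

theorem mem_nhds_zero (hK : IsStarBody K) : K ∈ 𝓝 (0 : E) :=
  mem_interior_iff_mem_nhds.1 hK.zero_mem_interior

theorem absorbent (hK : IsStarBody K) : Absorbent ℝ K :=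
  absorbent_nhds_zero hK.mem_nhds_zero

theorem exists_mem_Icc_smul_mem_frontier {x : E} {a b c d : ℝ} (ha : a ∈ Icc c d)
    (hb : b ∈ Icc c d) (haK : a • x ∈ K) (hbK : b • x ∉ K) :
    ∃ t ∈ Icc c d, t • x ∈ frontier K := by
  have hcont : Continuous fun t : ℝ => t • x := by fun_prop
  obtain ⟨t, ht, htf⟩ := (isPreconnected_Icc (a := c) (b := d)).exists_mem_frontier
    (u := (fun t : ℝ => t • x) ⁻¹' K) ha haK hb hbK
  exact ⟨t, ht, hcont.frontier_preimage_subset K htf⟩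

/-- If a segment from the origin to a point of `K` left `K`, its line would meet the frontier three
times: before the gap, beyond `x`, and on the opposite ray. -/
theorem starConvex (hK : IsStarBody K) : StarConvex ℝ 0 K := by
  rw [starConvex_zero_iff]
  intro x hx t₀ ht₀ ht₁
  by_contra hnot
  have h0K : (0 : E) ∈ K := interior_subset hK.zero_mem_interior
  have hx0 : x ≠ 0 := by rintro rfl; simp [h0K] at hnot
  obtain ⟨R, hR⟩ := hK.isCompact.isBounded.subset_closedBall 0
  have hxpos : 0 < ‖x‖ := norm_pos_iff.2 hx0
  -- `T` is chosen so that `T • x` and `-T • x` lie outside a ball containing `K`, and so that `[1,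
  -- T]` is nonempty.
  set T : ℝ := max 1 ((R + 1) / ‖x‖) with hT
  have hT1 : 1 ≤ T := le_max_left _ _
  have hTx : R + 1 ≤ T * ‖x‖ := by
    rw [← div_le_iff₀ hxpos]; exact le_max_right _ _
  have hout : ∀ t : ℝ, |t| = T → t • x ∉ K := fun t ht hmem => by
    have := hR hmem
    rw [mem_closedBall_zero_iff, norm_smul, Real.norm_eq_abs, ht] at this
    linarith
  have hnf : ∀ t : ℝ, t • x ∈ frontier K → t ≠ 0 := by
    rintro t ht rfl
    rw [zero_smul] at ht
    exact ht.2 hK.zero_mem_interior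
  have ht₀1 : t₀ ≠ 1 := by rintro rfl; simp [hx] at hnot
  obtain ⟨t₁, ht₁m, ht₁f⟩ := exists_mem_Icc_smul_mem_frontier (K := K) (x := x) (a := 0) (b := t₀)
    (c := 0) (d := t₀) ⟨le_rfl, ht₀⟩ ⟨ht₀, le_rfl⟩ (by simpa using h0K) hnot
  obtain ⟨t₂, ht₂m, ht₂f⟩ := exists_mem_Icc_smul_mem_frontier (K := K) (x := x) (a := 1) (b := T)
    (c := 1) (d := T) ⟨le_rfl, hT1⟩ ⟨hT1, le_rfl⟩ (by simpa using hx)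
    (hout T (abs_of_nonneg (by linarith)))
  obtain ⟨t₃, ht₃m, ht₃f⟩ := exists_mem_Icc_smul_mem_frontier (K := K) (x := x) (a := 0) (b := -T)
    (c := -T) (d := 0) ⟨by linarith, le_rfl⟩ ⟨le_rfl, by linarith⟩ (by simpa using h0K)
    (hout (-T) (by rw [abs_neg, abs_of_nonneg (by linarith)]))
  have hlt₁ : t₁ < t₂ := ht₁m.2.trans_lt ((lt_of_le_of_ne ht₁ ht₀1).trans_le ht₂m.1)
  have hlt₃ : t₃ < t₁ := (lt_of_le_of_ne ht₃m.2 (hnf _ ht₃f)).trans_le ht₁m.1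
  have hinj : ∀ {s t : ℝ}, s < t → s • x ≠ t • x := fun hst h =>
    hst.ne (smul_left_injective ℝ hx0 h)
  have hsub : ({t₁ • x, t₂ • x, t₃ • x} : Set E) ⊆
      ((Submodule.span ℝ {x} : Submodule ℝ E) : Set E) ∩ frontier K := by
    rintro y (rfl | rfl | rfl) <;>
      exact ⟨Submodule.smul_mem _ _ (Submodule.mem_span_singleton_self x), by assumption⟩
  have hcard := encard_le_encard hsub
  rw [hK.line_inter_frontier x hx0, encard_insert_of_notMem, encard_pair] at hcard
  · norm_num at hcard
  · exact (hinj (hlt₃.trans hlt₁)).symm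
  · rintro (h | h)
    · exact hinj hlt₁ h
    · exact hinj hlt₃ h.symm

/-- Star convexity settles gauge `< 1`; closedness of `K` adds the boundary case, as the limit of `t
• x` for `t < 1`. -/
theorem mem_iff_gauge_le_one (hK : IsStarBody K) {x : E} : x ∈ K ↔ gauge K x ≤ 1 := by
  refine ⟨gauge_le_one_of_mem, fun h => ?_⟩
  have hlt : ∀ y : E, gauge K y < 1 → y ∈ K := fun y hy => by
    by_contra hyK
    exact absurd (one_le_gauge_of_notMem hK.starConvex (hK.absorbent y) hyK) (not_le.2 hy)
  have hcl : IsClosed ((fun t : ℝ => t • x) ⁻¹' K) :=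
    hK.isCompact.isClosed.preimage (by fun_prop)
  have hsub : Ioo (0 : ℝ) 1 ⊆ (fun t : ℝ => t • x) ⁻¹' K := fun t ht => by
    refine hlt _ ?_
    rw [gauge_smul_of_nonneg ht.1.le, smul_eq_mul]
    nlinarith [ht.1, ht.2, gauge_nonneg (s := K) x]
  have h1 : (1 : ℝ) ∈ closure (Ioo (0 : ℝ) 1) := by
    rw [closure_Ioo zero_ne_one]; simp
  simpa using closure_minimal hsub hcl h1

theorem eq_of_gauge_eq {L : Set E} (hK : IsStarBody K) (hL : IsStarBody L)
    (h : ∀ x, gauge K x = gauge L x) : K = L := by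
  ext x
  rw [hK.mem_iff_gauge_le_one, hL.mem_iff_gauge_le_one, h]

theorem gauge_pos (hK : IsStarBody K) {x : E} (hx : x ≠ 0) : 0 < gauge K x :=
  (_root_.gauge_pos hK.absorbent
    (NormedSpace.isVonNBounded_iff ℝ |>.2 hK.isCompact.isBounded)).2 hx

theorem isOpen_gauge_lt (hK : IsStarBody K) (r : ℝ) : IsOpen {x | gauge K x < r} :=
  isOpen_lt hK.continuous_gauge continuous_const

theorem continuousAt_indicator (hK : IsStarBody K) {x : E} (hx : gauge K x ≠ 1) :
    ContinuousAt (K.indicator fun _ => (1 : ℝ)) x := by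
  rcases lt_or_gt_of_ne hx with h | h
  · refine (continuousAt_const (y := (1 : ℝ))).congr ?_
    filter_upwards [(hK.isOpen_gauge_lt 1).mem_nhds h] with y hy
    rw [indicator_of_mem (hK.mem_iff_gauge_le_one.2 (le_of_lt hy))]
  · refine (continuousAt_const (y := (0 : ℝ))).congr ?_
    filter_upwards [(isOpen_lt continuous_const hK.continuous_gauge).mem_nhds h] with y hy
    rw [indicator_of_notMem fun hy' => absurd (hK.mem_iff_gauge_le_one.1 hy') (not_le.2 hy)]

/-- The gauge sphere of a star body is null in every subspace. -/
theorem ae_gauge_ne_one (hK : IsStarBody K) [FiniteDimensional ℝ E] [MeasurableSpace E]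
    [BorelSpace E] (S : Submodule ℝ E) (μ : Measure S) [μ.IsAddHaarMeasure] :
    ∀ᵐ y : S ∂μ, gauge K (y : E) ≠ 1 := by
  set B : Set S := {y | gauge K (y : E) ≤ 1} with hB
  set T : Set S := {y | gauge K (y : E) = 1} with hT
  have hg : Continuous fun y : S => gauge K (y : E) :=
    hK.continuous_gauge.comp continuous_subtype_val
  have hBc : IsCompact B := by
    have : B = (Subtype.val : S → E) ⁻¹' K := by
      ext y; exact hK.mem_iff_gauge_le_one.symm
    rw [this]
    exact (Submodule.closed_of_finiteDimensional S).isClosedEmbedding_subtypeVal.isCompact_preimage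
      hK.isCompact
  have hBfin : μ B ≠ ⊤ := hBc.measure_lt_top.ne
  set d := Module.finrank ℝ S
  -- The dilate `s • B` lies in `B` and misses the gauge sphere `T`. Letting `s → 1` leaves no room
  -- for `T` in the finite measure of `B`.
  have hle : ∀ s ∈ Ioo (0 : ℝ) 1, μ T + ENNReal.ofReal (s ^ d) * μ B ≤ μ B := fun s hs => by
    have hsB : s • B = {y : S | gauge K (y : E) ≤ s} := by
      ext y
      rw [mem_smul_set_iff_inv_smul_mem₀ hs.1.ne']
      simp only [hB, mem_ofPred_eq, Submodule.coe_smul]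
      rw [gauge_smul_of_nonneg (inv_nonneg.2 hs.1.le), smul_eq_mul, inv_mul_le_iff₀ hs.1, mul_one]
    have hdisj : Disjoint T (s • B) := by
      rw [hsB, Set.disjoint_left]
      intro y hy hy'
      simp only [hT, mem_ofPred_eq] at hy hy'
      linarith [hs.2]
    have hmeas : MeasurableSet (s • B) := by
      rw [hsB]; exact (isClosed_le hg continuous_const).measurableSet
    have := measure_union (μ := μ) hdisj hmeas
    rw [Measure.addHaar_smul, abs_of_nonneg (pow_nonneg hs.1.le _)] at this
    rw [← this]
    refine measure_mono (union_subset (fun y hy => le_of_eq hy) ?_)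
    rw [hsB]
    exact fun y hy => le_trans hy hs.2.le
  have hlim : Tendsto (fun s : ℝ => μ T + ENNReal.ofReal (s ^ d) * μ B) (𝓝[<] 1)
      (𝓝 (μ T + ENNReal.ofReal ((1 : ℝ) ^ d) * μ B)) := by
    refine tendsto_const_nhds.add (ENNReal.Tendsto.mul_const ?_ (Or.inr hBfin))
    refine ((ENNReal.continuous_ofReal.comp (continuous_pow d)).tendsto 1).mono_left
      nhdsWithin_le_nhds
  have hfin := le_of_tendsto hlim (by
    filter_upwards [Ioo_mem_nhdsLT (zero_lt_one' ℝ)] with s hs using hle s hs)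
  rw [one_pow, ENNReal.ofReal_one, one_mul] at hfin
  have hT0 : μ T = 0 := by
    by_contra h0
    exact absurd (ENNReal.lt_add_right hBfin h0) (not_lt.2 (by rwa [add_comm] at hfin))
  rw [ae_iff]
  simpa [hT] using hT0

end IsStarBody

/-- The gauge of a complex star body is absolutely homogeneous over `ℂ`. -/
theorem IsSymmComplexStarBody.gauge_complex_smul {n : ℕ} {K : Set (EuclideanSpace ℂ (Fin n))}
    (hK : IsSymmComplexStarBody K) (c : ℂ) (x : EuclideanSpace ℂ (Fin n)) :
    gauge K (c • x) = ‖c‖ * gauge K x := by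
  obtain ⟨θ, hθ, hc⟩ : ∃ θ ∈ Icc (0 : ℝ) (2 * Real.pi),
      c = (‖c‖ : ℂ) * Complex.exp (θ * Complex.I) := by
    -- `Complex.arg` takes values in `(-π, π]`, while rotation invariance is given for `[0, 2π]`;
    -- negative arguments are shifted by `2π`.
    rcases le_or_gt 0 c.arg with h | h
    · exact ⟨c.arg, ⟨h, by linarith [Complex.arg_le_pi c, Real.pi_pos]⟩,
        (Complex.norm_mul_exp_arg_mul_I c).symm⟩
    · refine ⟨c.arg + 2 * Real.pi, ⟨by linarith [Complex.neg_pi_lt_arg c, Real.pi_pos],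
        by linarith⟩, ?_⟩
      have : ((c.arg + 2 * Real.pi : ℝ) : ℂ) * Complex.I
          = c.arg * Complex.I + 2 * Real.pi * Complex.I := by push_cast; ring
      rw [this, Complex.exp_add, Complex.exp_two_pi_mul_I, mul_one,
        Complex.norm_mul_exp_arg_mul_I]
  have hcx : c • x = ‖c‖ • (Complex.exp (θ * Complex.I) • x) := by
    conv_lhs => rw [hc]
    ext i
    simp [mul_assoc]
  rw [hcx, gauge_smul_of_nonneg (norm_nonneg c), hK.gauge_rotation θ hθ, smul_eq_mul]

/-! ### Gaussian integrals split along a subspace and its orthogonal complement -/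

section Gaussian

theorem norm_sq_add_orthogonal {E : Type*} [NormedAddCommGroup E] [InnerProductSpace ℝ E]
    (H : Submodule ℝ E) (y : H) (z : Hᗮ) : ‖(y : E) + z‖ ^ 2 = ‖y‖ ^ 2 + ‖z‖ ^ 2 := by
  have h := norm_add_sq_real (y : E) z
  rw [Submodule.inner_right_of_mem_orthogonal y.2 z.2] at h
  simpa using h

/-- By Pythagoras the Gaussian factors, and the factor in `z` is at most one. The resulting bound is
uniform over the translates of `H`. -/
theorem norm_le_exp_of_norm_le {E : Type*} [NormedAddCommGroup E]
    [InnerProductSpace ℝ E] (H : Submodule ℝ E) {D : E → ℂ} {C : ℝ} (hC : 0 ≤ C)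
    (hD : ∀ v, ‖D v‖ ≤ C * Real.exp (-‖v‖ ^ 2)) (y : H) (z : Hᗮ) :
    ‖D (y + z)‖ ≤ C * Real.exp (-‖y‖ ^ 2) := by
  refine (hD _).trans ?_
  rw [norm_sq_add_orthogonal]
  gcongr
  nlinarith [sq_nonneg ‖z‖]

theorem orthogonalProjectionOnto_orthogonal_add {E : Type*} [NormedAddCommGroup E]
    [InnerProductSpace ℝ E] (H : Submodule ℝ E) [Hᗮ.HasOrthogonalProjection] (y : H) (z : Hᗮ) :
    Hᗮ.orthogonalProjectionOnto ((y : E) + z) = z := by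
  rw [map_add, Submodule.orthogonalProjectionOnto_mem_subspace_eq_self,
    Submodule.orthogonalProjectionOnto_orthogonal_apply_eq_zero y.2, zero_add]

variable {E : Type*} [NormedAddCommGroup E] [InnerProductSpace ℝ E] [FiniteDimensional ℝ E]
  [MeasurableSpace E] [BorelSpace E]

theorem integrable_exp_neg_mul_sq_norm {b : ℝ} (hb : 0 < b) :
    Integrable fun v : E => Real.exp (-b * ‖v‖ ^ 2) := by
  have h := (GaussianFourier.integrable_cexp_neg_mul_sq_norm_add (b := (b : ℂ)) (by simpa using hb) 0
    (0 : E)).norm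
  refine h.congr (ae_of_all _ fun v => ?_)
  simp only [Complex.norm_exp]
  congr 1
  norm_cast
  simp

theorem Submodule.exists_measurableEquiv_add (H : Submodule ℝ E) :
    ∃ e : (H × Hᗮ) ≃ᵐ E, MeasurePreserving e ∧ ∀ p, e p = (p.1 : E) + p.2 := by
  let e := (H.orthogonalDecomposition.toHomeomorph.toMeasurableEquiv.trans
    (MeasurableEquiv.toLp 2 _).symm).symm
  refine ⟨e, ?_, fun p => ?_⟩
  · refine MeasurePreserving.symm (H.orthogonalDecomposition.toHomeomorph.toMeasurableEquiv.trans
      (MeasurableEquiv.toLp 2 _).symm) ?_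
    exact H.orthogonalDecomposition.measurePreserving.trans (WithLp.volume_preserving_ofLp _ _)
  · simp [e]

variable (H : Submodule ℝ E)

theorem integrable_exp_neg_sq_norm : Integrable fun v : E => Real.exp (-‖v‖ ^ 2) := by
  simpa using integrable_exp_neg_mul_sq_norm (E := E) one_pos

theorem integral_exp_neg_sq_norm :
    ∫ v : E, Real.exp (-‖v‖ ^ 2) = Real.pi ^ (Module.finrank ℝ E / 2 : ℝ) := by
  simpa using GaussianFourier.integral_rexp_neg_mul_sq_norm (V := E) one_pos

theorem norm_integral_add_orthogonal_le {D : E → ℂ} {C : ℝ} (hC : 0 ≤ C)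
    (hD : ∀ v, ‖D v‖ ≤ C * Real.exp (-‖v‖ ^ 2)) (z : Hᗮ) :
    ‖∫ y : H, D (y + z)‖ ≤ C * Real.pi ^ (Module.finrank ℝ H / 2 : ℝ) := by
  rw [← integral_exp_neg_sq_norm, ← integral_const_mul]
  exact norm_integral_le_of_norm_le (integrable_exp_neg_sq_norm.const_mul C)
    (ae_of_all _ fun y => norm_le_exp_of_norm_le H hC hD y z)

theorem tendsto_integral_add_orthogonal {D : E → ℂ} {C : ℝ} (hC : 0 ≤ C) (hDm : Measurable D)
    (hD : ∀ v, ‖D v‖ ≤ C * Real.exp (-‖v‖ ^ 2)) (hDc : ∀ᵐ y : H, ContinuousAt D y) :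
    Tendsto (fun z : Hᗮ => ∫ y : H, D (y + z)) (𝓝 0) (𝓝 (∫ y : H, D y)) := by
  refine tendsto_integral_filter_of_dominated_convergence
    (fun y : H => C * Real.exp (-‖y‖ ^ 2)) ?_ ?_ (integrable_exp_neg_sq_norm.const_mul C) ?_
  · exact Eventually.of_forall fun z =>
      (hDm.comp (measurable_subtype_coe.add_const (z : E))).aestronglyMeasurable
  · exact Eventually.of_forall fun z =>
      ae_of_all _ fun y => norm_le_exp_of_norm_le H hC hD y z
  · filter_upwards [hDc] with y hy
    have hlim : Tendsto (fun z : Hᗮ => (y : E) + z) (𝓝 0) (𝓝 (y : E)) := by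
      have : Continuous fun z : Hᗮ => (y : E) + z := by fun_prop
      simpa using this.tendsto 0
    exact hy.tendsto.comp hlim

/-- Fubini over `H × Hᗮ`, then `z = w / √m`. Since `Hᗮ` is a plane, the Jacobian `m⁻¹` cancels the
prefactor `m` exactly, and `m` survives only in the translate of `H`. -/
theorem integral_mul_gaussian_orthogonal {D : E → ℂ} {C : ℝ} (hDm : Measurable D)
    (hD : ∀ v, ‖D v‖ ≤ C * Real.exp (-‖v‖ ^ 2)) (hdim : Module.finrank ℝ Hᗮ = 2)
    {t m : ℝ} (ht : 0 < t) (hm : 0 < m) :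
    ∫ v : E, D v * ((m * Real.exp (-m * t * ‖Hᗮ.orthogonalProjectionOnto v‖ ^ 2) : ℝ) : ℂ) =
      ∫ w : Hᗮ, ((Real.exp (-t * ‖w‖ ^ 2) : ℝ) : ℂ) *
        ∫ y : H, D (y + (((Real.sqrt m)⁻¹ • w : Hᗮ) : E)) := by
  obtain ⟨e, he, hep⟩ := H.exists_measurableEquiv_add
  set F : E → ℂ := fun v =>
    D v * ((m * Real.exp (-m * t * ‖Hᗮ.orthogonalProjectionOnto v‖ ^ 2) : ℝ) : ℂ) with hF
  have hFi : Integrable F := by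
    have hDi : Integrable D := Integrable.mono' (integrable_exp_neg_sq_norm.const_mul C)
      hDm.aestronglyMeasurable (ae_of_all _ hD)
    refine hDi.mul_bdd (c := m) ?_ (ae_of_all _ fun v => ?_)
    · exact Continuous.aestronglyMeasurable (by fun_prop)
    · rw [Complex.norm_real, Real.norm_of_nonneg (by positivity)]
      refine mul_le_of_le_one_right hm.le (Real.exp_le_one_iff.2 ?_)
      have : 0 ≤ m * t * ‖Hᗮ.orthogonalProjectionOnto v‖ ^ 2 := by positivity
      linarith
  have hFe : Integrable (fun p : H × Hᗮ => F ((p.1 : E) + p.2)) := by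
    have := he.integrable_comp_of_integrable hFi
    simpa [Function.comp_def, hep] using this
  calc ∫ v, F v = ∫ p : H × Hᗮ, F ((p.1 : E) + p.2) := by
        rw [← he.integral_comp' F]; simp only [hep]
    _ = ∫ z : Hᗮ, ∫ y : H, F (y + z) := by
        rw [Measure.volume_eq_prod] at hFe ⊢
        exact integral_prod_symm _ hFe
    _ = ∫ z : Hᗮ, ((m * Real.exp (-m * t * ‖z‖ ^ 2) : ℝ) : ℂ) * ∫ y : H, D (y + z) := by
        congr 1 with z
        simp only [hF, orthogonalProjectionOnto_orthogonal_add]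
        rw [integral_mul_const, mul_comm]
    _ = _ := by
        have hs : 0 < Real.sqrt m := Real.sqrt_pos.2 hm
        have := Measure.integral_comp_inv_smul (volume : Measure Hᗮ)
          (fun z : Hᗮ => ((m * Real.exp (-m * t * ‖z‖ ^ 2) : ℝ) : ℂ) * ∫ y : H, D (y + z))
          (Real.sqrt m)
        rw [hdim, abs_of_nonneg (by positivity), Real.sq_sqrt hm.le] at this
        rw [← inv_smul_smul₀ hm.ne' (∫ z : Hᗮ, _), ← this, ← integral_smul]
        congr 1 with w
        rw [norm_smul, norm_inv, Real.norm_of_nonneg hs.le, mul_pow, inv_pow, Real.sq_sqrt hm.le,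
          Complex.real_smul, ← mul_assoc, ← Complex.ofReal_mul, ← mul_assoc,
          inv_mul_cancel₀ hm.ne', one_mul]
        congr 3
        field_simp

theorem integral_exp_neg_mul_sq_norm_of_finrank_eq_two (hdim : Module.finrank ℝ E = 2) {t : ℝ}
    (ht : 0 < t) : ∫ w : E, Real.exp (-t * ‖w‖ ^ 2) = Real.pi / t := by
  rw [GaussianFourier.integral_rexp_neg_mul_sq_norm ht, hdim]
  norm_num

/-- The bound does not involve `m`; with `t = ‖ξ‖ ^ 2` it supplies the dominating function in `ξ`.
-/
theorem norm_integral_mul_gaussian_orthogonal_le {D : E → ℂ} {C : ℝ} (hC : 0 ≤ C)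
    (hDm : Measurable D) (hD : ∀ v, ‖D v‖ ≤ C * Real.exp (-‖v‖ ^ 2))
    (hdim : Module.finrank ℝ Hᗮ = 2) {t m : ℝ} (ht : 0 < t) (hm : 0 < m) :
    ‖∫ v : E, D v * ((m * Real.exp (-m * t * ‖Hᗮ.orthogonalProjectionOnto v‖ ^ 2) : ℝ) : ℂ)‖ ≤
      Real.pi / t * (C * Real.pi ^ (Module.finrank ℝ H / 2 : ℝ)) := by
  rw [integral_mul_gaussian_orthogonal H hDm hD hdim ht hm,
    ← integral_exp_neg_mul_sq_norm_of_finrank_eq_two hdim ht, ← integral_mul_const]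
  refine norm_integral_le_of_norm_le ((integrable_exp_neg_mul_sq_norm ht).mul_const _)
    (ae_of_all _ fun w => ?_)
  rw [norm_mul, Complex.norm_real, Real.norm_of_nonneg (Real.exp_pos _).le]
  gcongr
  exact norm_integral_add_orthogonal_le H hC hD _

theorem tendsto_integral_mul_gaussian_orthogonal {D : E → ℂ} {C : ℝ} (hC : 0 ≤ C)
    (hDm : Measurable D) (hD : ∀ v, ‖D v‖ ≤ C * Real.exp (-‖v‖ ^ 2))
    (hDc : ∀ᵐ y : H, ContinuousAt D y) (hdim : Module.finrank ℝ Hᗮ = 2) {t : ℝ} (ht : 0 < t) :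
    Tendsto (fun m : ℝ => ∫ v : E, D v *
        ((m * Real.exp (-m * t * ‖Hᗮ.orthogonalProjectionOnto v‖ ^ 2) : ℝ) : ℂ)) atTop
      (𝓝 (((Real.pi / t : ℝ) : ℂ) * ∫ y : H, D y)) := by
  have hlim : Tendsto (fun m : ℝ => ∫ w : Hᗮ, ((Real.exp (-t * ‖w‖ ^ 2) : ℝ) : ℂ) *
      ∫ y : H, D (y + (((Real.sqrt m)⁻¹ • w : Hᗮ) : E))) atTop
      (𝓝 (∫ w : Hᗮ, ((Real.exp (-t * ‖w‖ ^ 2) : ℝ) : ℂ) * ∫ y : H, D y)) := by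
    refine tendsto_integral_filter_of_dominated_convergence
      (fun w : Hᗮ => Real.exp (-t * ‖w‖ ^ 2) * (C * Real.pi ^ (Module.finrank ℝ H / 2 : ℝ)))
      ?_ ?_ ((integrable_exp_neg_mul_sq_norm ht).mul_const _) ?_
    · refine Eventually.of_forall fun m => ?_
      refine (Continuous.aestronglyMeasurable (by fun_prop)).mul ?_
      have hmeas : StronglyMeasurable (Function.uncurry fun (w : Hᗮ) (y : H) =>
          D (y + (((Real.sqrt m)⁻¹ • w : Hᗮ) : E))) := by
        refine (hDm.comp ?_).stronglyMeasurable
        refine Continuous.measurable ?_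
        fun_prop
      exact hmeas.integral_prod_right.aestronglyMeasurable
    · refine Eventually.of_forall fun m => ae_of_all _ fun w => ?_
      rw [norm_mul, Complex.norm_real, Real.norm_of_nonneg (Real.exp_pos _).le]
      gcongr
      exact norm_integral_add_orthogonal_le H hC hD _
    · refine ae_of_all _ fun w => tendsto_const_nhds.mul ?_
      refine (tendsto_integral_add_orthogonal H hC hDm hD hDc).comp ?_
      have : Tendsto (fun m : ℝ => (Real.sqrt m)⁻¹ • w) atTop (𝓝 ((0 : ℝ) • w)) :=
        (tendsto_inv_atTop_zero.comp Real.tendsto_sqrt_atTop).smul_const w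
      simpa using this
  rw [integral_mul_const, integral_complex_ofReal,
    integral_exp_neg_mul_sq_norm_of_finrank_eq_two hdim ht] at hlim
  refine hlim.congr' ?_
  filter_upwards [eventually_gt_atTop 0] with m hm
  rw [integral_mul_gaussian_orthogonal H hDm hD hdim ht hm]

/-- The Fourier transform of a Gaussian that is sharpened in the directions orthogonal to `H`. -/
theorem integral_gaussian_mul_character (a : E) (s : ℝ) (hdim : Module.finrank ℝ Hᗮ = 2)
    {r : ℝ} (hr : 0 ≤ r) :
    ∫ v : E, Complex.exp (-1 * ‖v‖ ^ 2 + (s * Complex.I) * (inner ℝ a v : ℝ)) *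
        ((Real.exp (-r * ‖Hᗮ.orthogonalProjectionOnto v‖ ^ 2) : ℝ) : ℂ) =
      ((Real.pi ^ (Module.finrank ℝ H / 2 : ℝ) *
        Real.exp (-(s ^ 2 * ‖H.orthogonalProjectionOnto a‖ ^ 2 / 4)) *
        (Real.pi / (1 + r) *
          Real.exp (-(s ^ 2 * ‖Hᗮ.orthogonalProjectionOnto a‖ ^ 2 / (4 * (1 + r))))) : ℝ) : ℂ) := by
  obtain ⟨e, he, hep⟩ := H.exists_measurableEquiv_add
  rw [← he.integral_comp']
  have hsplit : ∀ p : H × Hᗮ,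
      Complex.exp (-1 * ‖e p‖ ^ 2 + (s * Complex.I) * (inner ℝ a (e p) : ℝ)) *
        ((Real.exp (-r * ‖Hᗮ.orthogonalProjectionOnto (e p)‖ ^ 2) : ℝ) : ℂ) =
      Complex.exp (-1 * ‖p.1‖ ^ 2 +
          (s * Complex.I) * (inner ℝ (H.orthogonalProjectionOnto a) p.1 : ℝ)) *
        Complex.exp (-((1 + r : ℝ) : ℂ) * ‖p.2‖ ^ 2 +
          (s * Complex.I) * (inner ℝ (Hᗮ.orthogonalProjectionOnto a) p.2 : ℝ)) := fun p => by
    rw [hep, orthogonalProjectionOnto_orthogonal_add, Complex.ofReal_exp, ← Complex.exp_add, ← Complex.exp_add]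
    congr 1
    have h1 : ((‖(p.1 : E) + p.2‖ : ℝ) : ℂ) ^ 2 = (‖p.1‖ : ℂ) ^ 2 + (‖p.2‖ : ℂ) ^ 2 := by
      exact_mod_cast congrArg (fun x : ℝ => (x : ℂ)) (norm_sq_add_orthogonal H p.1 p.2)
    rw [h1, inner_add_right, Submodule.inner_orthogonalProjectionOnto_eq_of_mem_right,
      Submodule.inner_orthogonalProjectionOnto_eq_of_mem_right]
    push_cast
    ring
  simp only [hsplit]
  rw [Measure.volume_eq_prod, integral_prod_mul
      (fun y : H => Complex.exp (-1 * ‖y‖ ^ 2 +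
        (s * Complex.I) * (inner ℝ (H.orthogonalProjectionOnto a) y : ℝ)))
      (fun z : Hᗮ => Complex.exp (-((1 + r : ℝ) : ℂ) * ‖z‖ ^ 2 +
        (s * Complex.I) * (inner ℝ (Hᗮ.orthogonalProjectionOnto a) z : ℝ))),
    GaussianFourier.integral_cexp_neg_mul_sq_norm_add (by simp),
    GaussianFourier.integral_cexp_neg_mul_sq_norm_add (by simp; linarith), hdim]
  have hI : ((s : ℂ) * Complex.I) ^ 2 = -(s : ℂ) ^ 2 := by rw [mul_pow, Complex.I_sq]; ring
  rw [hI]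
  push_cast
  rw [Complex.ofReal_cpow Real.pi_pos.le]
  push_cast
  congr 2
  · norm_num
  · congr 1; ring
  · norm_num
  · congr 1; ring

end Gaussian

/-! ### Geometry of complex hyperplanes -/

section Hyperplane

variable {n : ℕ}

theorem real_inner_eq_re_complex_inner (x y : EuclideanSpace ℂ (Fin n)) :
    inner ℝ x y = (inner ℂ x y).re := by
  simp [PiLp.inner_apply, Complex.inner]

theorem orthogonal_restrictScalars (W : Submodule ℂ (EuclideanSpace ℂ (Fin n))) :
    (W.restrictScalars ℝ)ᗮ = Wᗮ.restrictScalars ℝ := by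
  ext v
  simp only [Submodule.mem_orthogonal, Submodule.restrictScalars_mem,
    real_inner_eq_re_complex_inner]
  refine ⟨fun h w hw => Complex.ext (h w hw) ?_, fun h w hw => by rw [h w hw]; rfl⟩
  -- The real inner product with `i w` recovers the imaginary part of the complex one.
  have := h (Complex.I • w) (W.smul_mem _ hw)
  rw [inner_smul_left] at this
  simpa using this

theorem complexHyperplane_orthogonal (x : EuclideanSpace ℂ (Fin n)) :
    (complexHyperplane x)ᗮ = (Submodule.span ℂ {x}).restrictScalars ℝ := by
  rw [complexHyperplane, orthogonal_restrictScalars, Submodule.orthogonal_orthogonal]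

theorem finrank_complexHyperplane_orthogonal {x : EuclideanSpace ℂ (Fin n)} (hx : x ≠ 0) :
    Module.finrank ℝ (complexHyperplane x)ᗮ = 2 := by
  rw [complexHyperplane_orthogonal]
  change Module.finrank ℝ (Submodule.span ℂ {x}) = 2
  rw [finrank_real_of_complex, finrank_span_singleton hx]

theorem finrank_complexHyperplane {x : EuclideanSpace ℂ (Fin n)} (hx : x ≠ 0) :
    (Module.finrank ℝ (complexHyperplane x) / 2 : ℝ) = n - 1 := by
  have h := (complexHyperplane x).finrank_add_finrank_orthogonal
  rw [finrank_complexHyperplane_orthogonal hx, finrank_real_of_complex, finrank_euclideanSpace,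
    Fintype.card_fin] at h
  have h' : (Module.finrank ℝ (complexHyperplane x) : ℝ) + 2 = 2 * n := by exact_mod_cast h
  linarith

/-- Only the component of `v` on the complex line of `x` contributes. This turns the incidence
kernel into a Gaussian on `(complexHyperplane x)ᗮ`. -/
theorem norm_complex_inner_sq (x v : EuclideanSpace ℂ (Fin n)) :
    ‖inner ℂ x v‖ ^ 2 =
      ‖x‖ ^ 2 * ‖(complexHyperplane x)ᗮ.orthogonalProjectionOnto v‖ ^ 2 := by
  set H := complexHyperplane x with hH
  set z := Hᗮ.orthogonalProjectionOnto v with hz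
  have hzmem : (z : EuclideanSpace ℂ (Fin n)) ∈ Submodule.span ℂ {x} := by
    have : ∀ w ∈ Hᗮ, w ∈ Submodule.span ℂ {x} := fun w hw => by
      rwa [hH, complexHyperplane_orthogonal] at hw
    exact this _ z.2
  obtain ⟨c, hc⟩ := Submodule.mem_span_singleton.1 hzmem
  have hy : v - z ∈ H := by
    have := Submodule.sub_starProjection_mem_orthogonal (K := Hᗮ) v
    rwa [Submodule.orthogonal_orthogonal] at this
  have hin : inner ℂ x (v - z) = 0 :=
    Submodule.mem_orthogonal_singleton_iff_inner_right.1 hy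
  rw [inner_sub_right, sub_eq_zero] at hin
  rw [hin, Submodule.coe_norm, ← hc, inner_smul_right, inner_self_eq_norm_sq_to_K, norm_smul]
  simp
  ring

theorem norm_orthogonalProjectionOnto_complexHyperplane_sq {x : EuclideanSpace ℂ (Fin n)}
    (hx : x ≠ 0) (a : EuclideanSpace ℂ (Fin n)) :
    ‖(complexHyperplane x).orthogonalProjectionOnto a‖ ^ 2 =
      ‖a‖ ^ 2 - ‖inner ℂ x a‖ ^ 2 / ‖x‖ ^ 2 := by
  have h := Submodule.norm_sq_eq_add_norm_sq_projection a (complexHyperplane x)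
  rw [norm_complex_inner_sq, h, mul_div_cancel_left₀ _ (by positivity)]
  ring

theorem complexHyperplane_smul {c : ℂ} (hc : c ≠ 0) (x : EuclideanSpace ℂ (Fin n)) :
    complexHyperplane (c • x) = complexHyperplane x := by
  rw [complexHyperplane, complexHyperplane, Submodule.span_singleton_smul_eq (IsUnit.mk0 c hc)]

/-- In polar coordinates of real dimension `2n` the radial weight is `y ^ (2n - 3)`, integrable at
the origin because `n ≥ 2`. This controls the factor `|ξ|⁻²`. -/
theorem integrable_inv_sq_norm_mul_exp (hn : 2 ≤ n) :
    Integrable fun v : EuclideanSpace ℂ (Fin n) => (‖v‖ ^ 2)⁻¹ * Real.exp (-‖v‖ ^ 2) := by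
  have : Nonempty (Fin n) := ⟨⟨0, by omega⟩⟩
  have hd : Module.finrank ℝ (EuclideanSpace ℂ (Fin n)) = 2 * n := by
    rw [finrank_real_of_complex, finrank_euclideanSpace, Fintype.card_fin]
  refine (integrable_fun_norm_addHaar (volume : Measure (EuclideanSpace ℂ (Fin n)))
    (f := fun y : ℝ => (y ^ 2)⁻¹ * Real.exp (-y ^ 2))).2 ?_
  rw [hd]
  have h := integrableOn_rpow_mul_exp_neg_mul_sq one_pos
    (s := ((2 * n - 3 : ℕ) : ℝ)) (by linarith [Nat.cast_nonneg (α := ℝ) (2 * n - 3)])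
  refine h.congr_fun (fun y hy => ?_) measurableSet_Ioi
  have hy0 : y ≠ 0 := ne_of_gt hy
  have he : 2 * n - 1 = (2 * n - 3) + 2 := by omega
  simp only [Real.rpow_natCast, smul_eq_mul, he, pow_add]
  field_simp

end Hyperplane

/-! ### Duality for the complex Radon transform -/

section Radon

variable {n : ℕ} {D : EuclideanSpace ℂ (Fin n) → ℂ} {C : ℝ}

/-- The Gaussian character `ξ ↦ exp (-|ξ|² + i s ⟨a, ξ⟩)`. -/
noncomputable def gaussianCharacter (a : EuclideanSpace ℂ (Fin n)) (s : ℝ)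
    (ξ : EuclideanSpace ℂ (Fin n)) : ℂ :=
  Complex.exp (-1 * ‖ξ‖ ^ 2 + (s * Complex.I) * (inner ℝ a ξ : ℝ))

theorem norm_gaussianCharacter (a : EuclideanSpace ℂ (Fin n)) (s : ℝ)
    (ξ : EuclideanSpace ℂ (Fin n)) : ‖gaussianCharacter a s ξ‖ = Real.exp (-‖ξ‖ ^ 2) := by
  rw [gaussianCharacter, Complex.norm_exp]
  have h : ((‖ξ‖ : ℂ) ^ 2).re = ‖ξ‖ ^ 2 := by norm_cast
  simp [h]

theorem continuous_gaussianCharacter (a : EuclideanSpace ℂ (Fin n)) (s : ℝ) :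
    Continuous (gaussianCharacter a s) := by
  unfold gaussianCharacter
  fun_prop

/-- The Gaussian approximation `m exp (-m |⟨x, ξ⟩|²)` of the incidence relation `x ⊥ ξ`. -/
noncomputable def incidenceKernel (m : ℝ) (x ξ : EuclideanSpace ℂ (Fin n)) : ℝ :=
  m * Real.exp (-m * ‖inner ℂ x ξ‖ ^ 2)

theorem incidenceKernel_comm (m : ℝ) (x ξ : EuclideanSpace ℂ (Fin n)) :
    incidenceKernel m x ξ = incidenceKernel m ξ x := by
  rw [incidenceKernel, incidenceKernel, norm_inner_symm]

theorem incidenceKernel_eq (m : ℝ) (x ξ : EuclideanSpace ℂ (Fin n)) :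
    incidenceKernel m x ξ = m * Real.exp (-m * ‖x‖ ^ 2 *
      ‖(complexHyperplane x)ᗮ.orthogonalProjectionOnto ξ‖ ^ 2) := by
  rw [incidenceKernel, norm_complex_inner_sq, mul_assoc (-m)]

/-- For each `ξ ≠ 0` the inner integral tends to `π |ξ|⁻²` times the section integral of `D`, which
is zero; dominated convergence in `ξ` finishes. -/
theorem tendsto_integral_incidenceKernel_of_section_eq_zero (hn : 2 ≤ n) (hC : 0 ≤ C)
    (hDm : Measurable D) (hD : ∀ v, ‖D v‖ ≤ C * Real.exp (-‖v‖ ^ 2))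
    (hDc : ∀ ξ : EuclideanSpace ℂ (Fin n), ξ ≠ 0 → ∀ᵐ y : complexHyperplane ξ, ContinuousAt D y)
    (hzero : ∀ ξ : EuclideanSpace ℂ (Fin n), ξ ≠ 0 → ∫ y : complexHyperplane ξ, D y = 0)
    (a : EuclideanSpace ℂ (Fin n)) (s : ℝ) :
    Tendsto (fun m : ℝ => ∫ ξ, gaussianCharacter a s ξ * ∫ x, D x * (incidenceKernel m ξ x : ℂ))
      atTop (𝓝 0) := by
  have : Nonempty (Fin n) := ⟨⟨0, by omega⟩⟩
  have hne : ∀ᵐ ξ : EuclideanSpace ℂ (Fin n), ξ ≠ 0 := by simp [ae_iff]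
  rw [← integral_zero (EuclideanSpace ℂ (Fin n)) ℂ (μ := volume)]
  refine tendsto_integral_filter_of_dominated_convergence
    (fun ξ => (‖ξ‖ ^ 2)⁻¹ * Real.exp (-‖ξ‖ ^ 2) *
      (Real.pi * (C * Real.pi ^ ((n : ℝ) - 1)))) ?_ ?_
    ((integrable_inv_sq_norm_mul_exp hn).mul_const _) ?_
  · refine Eventually.of_forall fun m => ?_
    refine (continuous_gaussianCharacter a s).aestronglyMeasurable.mul ?_
    have hmeas : StronglyMeasurable (Function.uncurry fun ξ x : EuclideanSpace ℂ (Fin n) =>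
        D x * (incidenceKernel m ξ x : ℂ)) := by
      refine (hDm.comp measurable_snd).stronglyMeasurable.mul (Continuous.stronglyMeasurable ?_)
      unfold incidenceKernel
      fun_prop
    exact hmeas.integral_prod_right.aestronglyMeasurable
  · filter_upwards [eventually_gt_atTop 0] with m hm
    filter_upwards [hne] with ξ hξ
    have hξ2 : 0 < ‖ξ‖ ^ 2 := by positivity
    have h := norm_integral_mul_gaussian_orthogonal_le (complexHyperplane ξ) hC hDm hD
      (finrank_complexHyperplane_orthogonal hξ) hξ2 hm
    rw [finrank_complexHyperplane hξ] at h
    simp only [← incidenceKernel_eq] at h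
    rw [norm_mul, norm_gaussianCharacter]
    calc _ ≤ Real.exp (-‖ξ‖ ^ 2) * (Real.pi / ‖ξ‖ ^ 2 * (C * Real.pi ^ ((n : ℝ) - 1))) := by
          gcongr
      _ = _ := by rw [div_eq_mul_inv]; ring
  · filter_upwards [hne] with ξ hξ
    have hξ2 : 0 < ‖ξ‖ ^ 2 := by positivity
    have h := tendsto_integral_mul_gaussian_orthogonal (complexHyperplane ξ) hC hDm hD (hDc ξ hξ)
      (finrank_complexHyperplane_orthogonal hξ) hξ2
    simp only [← incidenceKernel_eq] at h
    rw [hzero ξ hξ, mul_zero] at h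
    simpa using h.const_mul (gaussianCharacter a s ξ)

theorem integral_gaussianCharacter_mul_incidenceKernel {x : EuclideanSpace ℂ (Fin n)} (hx : x ≠ 0)
    (a : EuclideanSpace ℂ (Fin n)) (s : ℝ) {m : ℝ} (hm : 0 < m) :
    ∫ ξ, gaussianCharacter a s ξ * (incidenceKernel m x ξ : ℂ) =
      ((Real.pi ^ ((n : ℝ) - 1) *
        Real.exp (-(s ^ 2 * (‖a‖ ^ 2 - ‖inner ℂ x a‖ ^ 2 / ‖x‖ ^ 2) / 4)) *
        (m * Real.pi / (1 + m * ‖x‖ ^ 2) *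
          Real.exp (-(s ^ 2 * ‖(complexHyperplane x)ᗮ.orthogonalProjectionOnto a‖ ^ 2 /
            (4 * (1 + m * ‖x‖ ^ 2))))) : ℝ) : ℂ) := by
  have h := integral_gaussian_mul_character (complexHyperplane x) a s
    (finrank_complexHyperplane_orthogonal hx) (r := m * ‖x‖ ^ 2) (by positivity)
  rw [finrank_complexHyperplane hx, norm_orthogonalProjectionOnto_complexHyperplane_sq hx] at h
  have hker : ∀ ξ, gaussianCharacter a s ξ * (incidenceKernel m x ξ : ℂ) =
      (m : ℂ) * (Complex.exp (-1 * ‖ξ‖ ^ 2 + (s * Complex.I) * (inner ℝ a ξ : ℝ)) *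
        ((Real.exp (-(m * ‖x‖ ^ 2) *
          ‖(complexHyperplane x)ᗮ.orthogonalProjectionOnto ξ‖ ^ 2) : ℝ) : ℂ)) := fun ξ => by
    rw [incidenceKernel_eq, gaussianCharacter, Complex.ofReal_mul, neg_mul m]
    ring
  simp only [hker]
  rw [integral_const_mul, h, ← Complex.ofReal_mul]
  congr 1
  ring

/-- The opposite order of integration. The inner integral is explicit, and vanishing of `D` near the
origin keeps the limiting weight `π / |x|²` bounded by `π / r²` where it matters. -/
theorem tendsto_integral_incidenceKernel {r : ℝ} (hr : 0 < r)
    (hDm : Measurable D) (hD : ∀ v, ‖D v‖ ≤ C * Real.exp (-‖v‖ ^ 2))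
    (hDr : ∀ v, ‖v‖ < r → D v = 0) (a : EuclideanSpace ℂ (Fin n)) (s : ℝ) :
    Tendsto (fun m : ℝ => ∫ x, D x * ∫ ξ, gaussianCharacter a s ξ * (incidenceKernel m x ξ : ℂ))
      atTop (𝓝 (∫ x, D x * ((Real.pi ^ ((n : ℝ) - 1) *
        Real.exp (-(s ^ 2 * (‖a‖ ^ 2 - ‖inner ℂ x a‖ ^ 2 / ‖x‖ ^ 2) / 4)) *
          (Real.pi / ‖x‖ ^ 2) : ℝ) : ℂ))) := by
  have hDi : Integrable D := Integrable.mono' (integrable_exp_neg_sq_norm.const_mul C)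
    hDm.aestronglyMeasurable (ae_of_all _ hD)
  refine tendsto_integral_filter_of_dominated_convergence
    (fun x => ‖D x‖ * (Real.pi ^ ((n : ℝ) - 1) * (Real.pi / r ^ 2))) ?_ ?_
    (hDi.norm.mul_const _) ?_
  · refine Eventually.of_forall fun m => hDm.aestronglyMeasurable.mul ?_
    have hmeas : StronglyMeasurable (Function.uncurry fun x ξ : EuclideanSpace ℂ (Fin n) =>
        gaussianCharacter a s ξ * (incidenceKernel m x ξ : ℂ)) := by
      refine Continuous.stronglyMeasurable ?_
      refine ((continuous_gaussianCharacter a s).comp continuous_snd).mul ?_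
      unfold incidenceKernel
      fun_prop
    exact hmeas.integral_prod_right.aestronglyMeasurable
  · filter_upwards [eventually_gt_atTop 0] with m hm
    refine ae_of_all _ fun x => ?_
    rw [norm_mul]
    rcases lt_or_ge ‖x‖ r with hxr | hxr
    · simp [hDr x hxr]
    have hx : x ≠ 0 := norm_pos_iff.1 (hr.trans_le hxr)
    -- The difference in the exponent is a squared projection norm; its sign is recorded in expanded
    -- form for `positivity`.
    have hψ := sq_nonneg ‖(complexHyperplane x).orthogonalProjectionOnto a‖
    rw [norm_orthogonalProjectionOnto_complexHyperplane_sq hx] at hψ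
    refine mul_le_mul_of_nonneg_left ?_ (norm_nonneg _)
    rw [integral_gaussianCharacter_mul_incidenceKernel hx a s hm, Complex.norm_real,
      Real.norm_of_nonneg (by positivity)]
    have h1 : Real.exp (-(s ^ 2 * (‖a‖ ^ 2 - ‖inner ℂ x a‖ ^ 2 / ‖x‖ ^ 2) / 4)) ≤ 1 := by
      rw [Real.exp_le_one_iff, neg_nonpos]; positivity
    have h2 : Real.exp (-(s ^ 2 * ‖(complexHyperplane x)ᗮ.orthogonalProjectionOnto a‖ ^ 2 /
            (4 * (1 + m * ‖x‖ ^ 2)))) ≤ 1 := by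
      rw [Real.exp_le_one_iff, neg_nonpos]; positivity
    have h3 : m * Real.pi / (1 + m * ‖x‖ ^ 2) ≤ Real.pi / r ^ 2 := by
      rw [div_le_div_iff₀ (by positivity) (by positivity)]
      have : r ^ 2 ≤ ‖x‖ ^ 2 := by gcongr
      nlinarith [mul_le_mul_of_nonneg_left this (by positivity : 0 ≤ m * Real.pi), Real.pi_pos]
    calc _ ≤ Real.pi ^ ((n : ℝ) - 1) * 1 * (Real.pi / r ^ 2 * 1) := by gcongr
      _ = _ := by ring
  · refine ae_of_all _ fun x => ?_
    rcases lt_or_ge ‖x‖ r with hxr | hxr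
    · simp [hDr x hxr]
    have hx : x ≠ 0 := norm_pos_iff.1 (hr.trans_le hxr)
    have hx2 : 0 < ‖x‖ ^ 2 := by positivity
    refine tendsto_const_nhds.mul ?_
    have hlim : Tendsto (fun m : ℝ => Real.pi ^ ((n : ℝ) - 1) *
        Real.exp (-(s ^ 2 * (‖a‖ ^ 2 - ‖inner ℂ x a‖ ^ 2 / ‖x‖ ^ 2) / 4)) *
        (m * Real.pi / (1 + m * ‖x‖ ^ 2) *
          Real.exp (-(s ^ 2 * ‖(complexHyperplane x)ᗮ.orthogonalProjectionOnto a‖ ^ 2 /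
            (4 * (1 + m * ‖x‖ ^ 2)))))) atTop
        (𝓝 (Real.pi ^ ((n : ℝ) - 1) *
        Real.exp (-(s ^ 2 * (‖a‖ ^ 2 - ‖inner ℂ x a‖ ^ 2 / ‖x‖ ^ 2) / 4)) *
          (Real.pi / ‖x‖ ^ 2 * Real.exp (-0)))) := by
      have hden : Tendsto (fun m : ℝ => 1 + m * ‖x‖ ^ 2) atTop atTop :=
        tendsto_atTop_add_const_left _ _ (tendsto_id.atTop_mul_const hx2)
      refine tendsto_const_nhds.mul (Tendsto.mul ?_ ?_)
      · have : Tendsto (fun m : ℝ => Real.pi / (m⁻¹ + ‖x‖ ^ 2)) atTop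
            (𝓝 (Real.pi / (0 + ‖x‖ ^ 2))) :=
          tendsto_const_nhds.div (tendsto_inv_atTop_zero.add_const _) (by simpa using hx2.ne')
        rw [zero_add] at this
        refine this.congr' ?_
        filter_upwards [eventually_gt_atTop 0] with m hm
        field_simp
      · refine (Real.continuous_exp.tendsto _).comp (Tendsto.neg ?_)
        exact tendsto_const_nhds.div_atTop (hden.const_mul_atTop (by norm_num))
    rw [neg_zero, Real.exp_zero, mul_one] at hlim
    refine ((Complex.continuous_ofReal.tendsto _).comp hlim).congr' ?_
    filter_upwards [eventually_gt_atTop 0] with m hm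
    rw [integral_gaussianCharacter_mul_incidenceKernel hx a s hm, Function.comp_apply]

/-- If all central complex hyperplane sections of `D` have integral zero, then `|x|⁻² D` is
orthogonal to the kernels `exp (-s² |P_x a|² / 4)`, where `P_x` is the projection onto the
complex hyperplane orthogonal to `x`. -/
theorem integral_mul_kernel_eq_zero (hn : 2 ≤ n) (hC : 0 ≤ C) {r : ℝ} (hr : 0 < r)
    (hDm : Measurable D) (hD : ∀ v, ‖D v‖ ≤ C * Real.exp (-‖v‖ ^ 2))
    (hDr : ∀ v, ‖v‖ < r → D v = 0)
    (hDc : ∀ ξ : EuclideanSpace ℂ (Fin n), ξ ≠ 0 → ∀ᵐ y : complexHyperplane ξ, ContinuousAt D y)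
    (hzero : ∀ ξ : EuclideanSpace ℂ (Fin n), ξ ≠ 0 → ∫ y : complexHyperplane ξ, D y = 0)
    (a : EuclideanSpace ℂ (Fin n)) (s : ℝ) :
    ∫ x, D x * ((Real.exp (-(s ^ 2 * (‖a‖ ^ 2 - ‖inner ℂ x a‖ ^ 2 / ‖x‖ ^ 2) / 4)) *
          (‖x‖ ^ 2)⁻¹ : ℝ) : ℂ) = 0 := by
  have hDi : Integrable D := Integrable.mono' (integrable_exp_neg_sq_norm.const_mul C)
    hDm.aestronglyMeasurable (ae_of_all _ hD)
  have hφi : Integrable (gaussianCharacter a s) :=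
    Integrable.mono' integrable_exp_neg_sq_norm
      (continuous_gaussianCharacter a s).aestronglyMeasurable
      (ae_of_all _ fun ξ => (norm_gaussianCharacter a s ξ).le)
  have hswap : ∀ m : ℝ, 0 < m →
      ∫ ξ, gaussianCharacter a s ξ * ∫ x, D x * (incidenceKernel m ξ x : ℂ) =
      ∫ x, D x * ∫ ξ, gaussianCharacter a s ξ * (incidenceKernel m x ξ : ℂ) := fun m hm => by
    simp only [← integral_const_mul]
    rw [integral_integral_swap]
    · congr 1 with x
      congr 1 with ξ
      rw [incidenceKernel_comm m ξ x]
      ring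
    · have hprod : Integrable (fun p : EuclideanSpace ℂ (Fin n) × EuclideanSpace ℂ (Fin n) =>
          gaussianCharacter a s p.1 * D p.2 * (incidenceKernel m p.1 p.2 : ℂ))
          (volume.prod volume) := by
        refine (hφi.mul_prod hDi).mul_bdd (c := m) ?_ (ae_of_all _ fun p => ?_)
        · refine Continuous.aestronglyMeasurable ?_
          unfold incidenceKernel
          fun_prop
        · rw [Complex.norm_real, incidenceKernel, Real.norm_of_nonneg (by positivity)]
          refine mul_le_of_le_one_right hm.le (Real.exp_le_one_iff.2 ?_)
          have : 0 ≤ m * ‖inner ℂ p.1 p.2‖ ^ 2 := by positivity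
          linarith
      refine hprod.congr (ae_of_all _ fun p => ?_)
      simp only [Function.uncurry]
      ring
  have h1 := tendsto_integral_incidenceKernel_of_section_eq_zero hn hC hDm hD hDc hzero a s
  have h2 := tendsto_integral_incidenceKernel hr hDm hD hDr a s
  have h3 := tendsto_nhds_unique (h1.congr' (by
    filter_upwards [eventually_gt_atTop 0] with m hm using hswap m hm)) h2
  have hc : ((Real.pi ^ ((n : ℝ) - 1) * Real.pi : ℝ) : ℂ) ≠ 0 :=
    Complex.ofReal_ne_zero.2 (by positivity)
  refine (mul_eq_zero.1 ?_).resolve_left hc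
  rw [← integral_const_mul, h3]
  congr 1 with x
  rw [div_eq_mul_inv]
  push_cast
  ring

end Radon

/-! ### Localization near a complex line and uniqueness -/

section Uniqueness

variable {n : ℕ} {K L : Set (EuclideanSpace ℂ (Fin n))}

/-- A vector that makes a small angle with the complex line of the unit vector `a` is a complex
multiple of a vector close to `a`. -/
theorem exists_smul_eq_of_inner_sq_gt {a x : EuclideanSpace ℂ (Fin n)} (ha : ‖a‖ = 1) {ρ : ℝ}
    (hρ : 0 < ρ) (hx : ‖x‖ ^ 2 < (1 + ρ ^ 2) * ‖inner ℂ x a‖ ^ 2) :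
    ∃ (c : ℂ) (w : EuclideanSpace ℂ (Fin n)), c ≠ 0 ∧ c • w = x ∧ ‖w - a‖ < ρ := by
  set c : ℂ := inner ℂ a x with hc
  have hcx : ‖inner ℂ x a‖ = ‖c‖ := norm_inner_symm x a
  rw [hcx] at hx
  have hc0 : c ≠ 0 := by
    intro h0
    rw [h0, norm_zero] at hx
    nlinarith [sq_nonneg ‖x‖]
  refine ⟨c, c⁻¹ • x, hc0, smul_inv_smul₀ hc0 x, ?_⟩
  have hcpos : 0 < ‖c‖ ^ 2 := by positivity
  have hin : inner ℂ a (c⁻¹ • x) = 1 := by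
    rw [inner_smul_right, ← hc, inv_mul_cancel₀ hc0]
  -- This is the squared tangent of the angle between `x` and the complex line of `a`.
  have hsq : ‖c⁻¹ • x - a‖ ^ 2 = ‖x‖ ^ 2 / ‖c‖ ^ 2 - 1 := by
    rw [@norm_sub_sq ℂ, ← inner_conj_symm, hin, ha, norm_smul, norm_inv, mul_pow, inv_pow]
    simp
    ring
  have hlt : ‖c⁻¹ • x - a‖ ^ 2 < ρ ^ 2 := by
    rw [hsq, sub_lt_iff_lt_add, div_lt_iff₀ hcpos]
    linarith
  exact lt_of_pow_lt_pow_left₀ 2 hρ.le hlt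

theorem IsSymmComplexStarBody.exists_cone_gauge_lt (hK : IsSymmComplexStarBody K)
    (hL : IsSymmComplexStarBody L) {a : EuclideanSpace ℂ (Fin n)} (ha : ‖a‖ = 1)
    (hlt : gauge K a < gauge L a) :
    ∃ η ∈ Ioo (0 : ℝ) 1, ∀ x : EuclideanSpace ℂ (Fin n), x ≠ 0 →
      1 - ‖inner ℂ x a‖ ^ 2 / ‖x‖ ^ 2 < η → gauge K x < gauge L x := by
  obtain ⟨ρ, hρ, hball⟩ := Metric.isOpen_iff.1
    (isOpen_lt hK.isStarBody.continuous_gauge hL.isStarBody.continuous_gauge) a hlt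
  -- Squared sine below `ρ² / (1 + ρ²)` means squared tangent below `ρ²`; complex homogeneity then
  -- carries the inequality from the ball around `a` to the whole cone.
  refine ⟨ρ ^ 2 / (1 + ρ ^ 2), ⟨by positivity, by rw [div_lt_one (by positivity)]; linarith⟩,
    fun x hx hψ => ?_⟩
  have hx2 : 0 < ‖x‖ ^ 2 := by positivity
  obtain ⟨c, w, hc, rfl, hw⟩ := exists_smul_eq_of_inner_sq_gt (x := x) ha hρ (by
    have h1 : 1 / (1 + ρ ^ 2) < ‖inner ℂ x a‖ ^ 2 / ‖x‖ ^ 2 := by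
      have : ρ ^ 2 / (1 + ρ ^ 2) = 1 - 1 / (1 + ρ ^ 2) := by field_simp; ring
      linarith
    rw [div_lt_div_iff₀ (by positivity) hx2] at h1
    linarith)
  rw [hK.gauge_complex_smul, hL.gauge_complex_smul]
  exact mul_lt_mul_of_pos_left (hball (by rwa [mem_ball_iff_norm])) (norm_pos_iff.2 hc)

/-- The difference of the indicator functions of two sets. -/
noncomputable def indicatorDiff (K L : Set (EuclideanSpace ℂ (Fin n)))
    (x : EuclideanSpace ℂ (Fin n)) : ℝ :=
  K.indicator (fun _ => 1) x - L.indicator (fun _ => 1) x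

theorem abs_indicatorDiff_le_one (x : EuclideanSpace ℂ (Fin n)) : |indicatorDiff K L x| ≤ 1 := by
  unfold indicatorDiff
  by_cases h1 : x ∈ K <;> by_cases h2 : x ∈ L <;> simp [h1, h2]

theorem measurable_indicatorDiff (hK : MeasurableSet K) (hL : MeasurableSet L) :
    Measurable (indicatorDiff K L) :=
  (measurable_const.indicator hK).sub (measurable_const.indicator hL)

/-- Boundedness of the two sets puts their indicator difference under the Gaussian bound required by
the Radon estimates. -/
theorem abs_indicatorDiff_le_exp {R : ℝ} (hKR : K ⊆ Metric.closedBall 0 R)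
    (hLR : L ⊆ Metric.closedBall 0 R) (x : EuclideanSpace ℂ (Fin n)) :
    |indicatorDiff K L x| ≤ Real.exp (R ^ 2) * Real.exp (-‖x‖ ^ 2) := by
  by_cases h : x ∈ K ∪ L
  · have hx : ‖x‖ ≤ R := mem_closedBall_zero_iff.1 (union_subset hKR hLR h)
    refine (abs_indicatorDiff_le_one x).trans ?_
    rw [← Real.exp_add]
    refine Real.one_le_exp ?_
    have : ‖x‖ ^ 2 ≤ R ^ 2 := by gcongr
    linarith
  · have h1 : x ∉ K := fun hk => h (Or.inl hk)
    have h2 : x ∉ L := fun hl => h (Or.inr hl)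
    simp only [indicatorDiff, h1, h2, not_false_eq_true, indicator_of_notMem, sub_zero, abs_zero]
    positivity

theorem integral_indicator_complexHyperplane (hK : MeasurableSet K)
    (ξ : EuclideanSpace ℂ (Fin n)) :
    ∫ y : complexHyperplane ξ, K.indicator (fun _ => (1 : ℝ)) (y : EuclideanSpace ℂ (Fin n)) =
      (sectionVolume K (complexHyperplane ξ)).toReal := by
  have hS : MeasurableSet ((Subtype.val : complexHyperplane ξ → _) ⁻¹' K) :=
    hK.preimage measurable_subtype_coe
  exact integral_indicator_one hS

theorem integrable_indicator_complexHyperplane (hK : IsCompact K)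
    (ξ : EuclideanSpace ℂ (Fin n)) :
    Integrable fun y : complexHyperplane ξ =>
      K.indicator (fun _ => (1 : ℝ)) (y : EuclideanSpace ℂ (Fin n)) := by
  have hc : IsCompact ((Subtype.val : complexHyperplane ξ → _) ⁻¹' K) :=
    (Submodule.closed_of_finiteDimensional
      (complexHyperplane ξ)).isClosedEmbedding_subtypeVal.isCompact_preimage hK
  exact (integrable_indicator_iff hc.measurableSet).2
    (integrableOn_const hc.measure_lt_top.ne)

theorem integral_indicatorDiff_eq_zero (hK : IsCompact K) (hL : IsCompact L)
    (h : ∀ ξ : EuclideanSpace ℂ (Fin n), ‖ξ‖ = 1 →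
      sectionVolume K (complexHyperplane ξ) = sectionVolume L (complexHyperplane ξ))
    {ξ : EuclideanSpace ℂ (Fin n)} (hξ : ξ ≠ 0) :
    ∫ y : complexHyperplane ξ, indicatorDiff K L y = 0 := by
  have hunit : sectionVolume K (complexHyperplane ξ) = sectionVolume L (complexHyperplane ξ) := by
    have hc : ((‖ξ‖ : ℂ)⁻¹) ≠ 0 := by simpa using hξ
    have := h ((‖ξ‖ : ℂ)⁻¹ • ξ) (by
      rw [norm_smul, norm_inv, Complex.norm_real, norm_norm, inv_mul_cancel₀ (by simpa using hξ)])
    rwa [complexHyperplane_smul hc] at this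
  unfold indicatorDiff
  rw [integral_sub (integrable_indicator_complexHyperplane hK ξ)
    (integrable_indicator_complexHyperplane hL ξ),
    integral_indicator_complexHyperplane hK.measurableSet,
    integral_indicator_complexHyperplane hL.measurableSet, hunit, sub_self]

theorem IsSymmComplexStarBody.integral_indicatorDiff_mul_kernel_eq_zero (hn : 2 ≤ n)
    (hK : IsSymmComplexStarBody K) (hL : IsSymmComplexStarBody L)
    (h : ∀ ξ : EuclideanSpace ℂ (Fin n), ‖ξ‖ = 1 →
      sectionVolume K (complexHyperplane ξ) = sectionVolume L (complexHyperplane ξ))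
    {r : ℝ} (hr : 0 < r) (hDr : ∀ v, ‖v‖ < r → indicatorDiff K L v = 0)
    (a : EuclideanSpace ℂ (Fin n)) (s : ℝ) :
    ∫ x, indicatorDiff K L x *
      (Real.exp (-(s ^ 2 * (‖a‖ ^ 2 - ‖inner ℂ x a‖ ^ 2 / ‖x‖ ^ 2) / 4)) * (‖x‖ ^ 2)⁻¹) = 0 := by
  have hKc := hK.isStarBody.isCompact
  have hLc := hL.isStarBody.isCompact
  obtain ⟨R, hR⟩ := (hKc.union hLc).isBounded.subset_closedBall 0
  have key := integral_mul_kernel_eq_zero (D := fun x => (indicatorDiff K L x : ℂ))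
    (C := Real.exp (R ^ 2)) hn (Real.exp_pos _).le hr
    (Complex.measurable_ofReal.comp
      (measurable_indicatorDiff hKc.measurableSet hLc.measurableSet))
    (fun v => by
      rw [Complex.norm_real, Real.norm_eq_abs]
      exact abs_indicatorDiff_le_exp (subset_union_left.trans hR) (subset_union_right.trans hR) v)
    (fun v hv => by rw [hDr v hv, Complex.ofReal_zero])
    (fun ξ _ => by
      have hgK : ∀ᵐ y : complexHyperplane ξ, gauge K (y : EuclideanSpace ℂ (Fin n)) ≠ 1 :=
        hK.isStarBody.ae_gauge_ne_one (complexHyperplane ξ) _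
      have hgL : ∀ᵐ y : complexHyperplane ξ, gauge L (y : EuclideanSpace ℂ (Fin n)) ≠ 1 :=
        hL.isStarBody.ae_gauge_ne_one (complexHyperplane ξ) _
      filter_upwards [hgK, hgL] with y hyK hyL
      exact Complex.continuous_ofReal.continuousAt.comp
        ((hK.isStarBody.continuousAt_indicator hyK).sub (hL.isStarBody.continuousAt_indicator hyL)))
    (fun ξ hξ => by
      rw [integral_complex_ofReal, integral_indicatorDiff_eq_zero hKc hLc h hξ, Complex.ofReal_zero])
    a s
  simp only [← Complex.ofReal_mul] at key
  rw [integral_complex_ofReal] at key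
  exact_mod_cast key

theorem IsSymmComplexStarBody.gauge_le_of_norm_eq_one (hn : 2 ≤ n)
    (hK : IsSymmComplexStarBody K) (hL : IsSymmComplexStarBody L)
    (h : ∀ ξ : EuclideanSpace ℂ (Fin n), ‖ξ‖ = 1 →
      sectionVolume K (complexHyperplane ξ) = sectionVolume L (complexHyperplane ξ))
    {a : EuclideanSpace ℂ (Fin n)} (ha : ‖a‖ = 1) : gauge L a ≤ gauge K a := by
  by_contra! hlt
  have hKc := hK.isStarBody.isCompact
  have hLc := hL.isStarBody.isCompact
  have hKg := hK.isStarBody.continuous_gauge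
  have hLg := hL.isStarBody.continuous_gauge
  obtain ⟨R, hR0, hR⟩ := (hKc.union hLc).isBounded.subset_closedBall_lt 0 0
  obtain ⟨r, hr, hrball⟩ := Metric.mem_nhds_iff.1
    (inter_mem hK.isStarBody.mem_nhds_zero hL.isStarBody.mem_nhds_zero)
  have hDr : ∀ v, ‖v‖ < r → indicatorDiff K L v = 0 := fun v hv => by
    have hv' := hrball (mem_ball_zero_iff.2 hv)
    simp [indicatorDiff, hv'.1, hv'.2]
  obtain ⟨η, ⟨hη0, hη1⟩, hcone⟩ := hK.exists_cone_gauge_lt hL ha hlt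
  -- `U` lies in `K \ L` and in the narrower cone where the squared sine is below `η / 2`. There the
  -- kernel exceeds `exp (-s² η / 8)` up to a constant, against at most `exp (-s² η / 4)` outside
  -- the cone of aperture `η`.
  set U : Set (EuclideanSpace ℂ (Fin n)) := {x | gauge K x < 1} ∩ {x | 1 < gauge L x} ∩
    {x | (1 - η / 2) * ‖x‖ ^ 2 < ‖inner ℂ x a‖ ^ 2} with hU
  have hUo : IsOpen U := ((isOpen_lt hKg continuous_const).inter
    (isOpen_lt continuous_const hLg)).inter (isOpen_lt (by fun_prop) (by fun_prop))
  have ha0 : a ≠ 0 := by rintro rfl; simp at ha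
  have hgK := hK.isStarBody.gauge_pos ha0
  have hgL := hL.isStarBody.gauge_pos ha0
  have hUne : U.Nonempty := by
    obtain ⟨t, ht1, ht2⟩ := exists_between ((inv_lt_inv₀ hgL hgK).2 hlt)
    have ht0 : 0 < t := (inv_pos.2 hgL).trans ht1
    refine ⟨t • a, ⟨?_, ?_⟩, ?_⟩
    · rw [mem_ofPred_eq, gauge_smul_of_nonneg ht0.le, smul_eq_mul, ← lt_div_iff₀ hgK, one_div]
      exact ht2
    · rw [mem_ofPred_eq, gauge_smul_of_nonneg ht0.le, smul_eq_mul, ← div_lt_iff₀ hgL, one_div]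
      exact ht1
    · have hin : ‖inner ℂ (t • a) a‖ = t := by
        have : (t • a : EuclideanSpace ℂ (Fin n)) = (t : ℂ) • a := by ext i; simp
        rw [this, inner_smul_left, inner_self_eq_norm_sq_to_K, ha]
        simp [abs_of_pos ht0]
      rw [mem_ofPred_eq, hin, norm_smul, ha, mul_one, Real.norm_of_nonneg ht0.le]
      nlinarith [sq_pos_of_pos ht0]
  have hUK : U ⊆ K := fun x hx => hK.isStarBody.mem_iff_gauge_le_one.2 hx.1.1.le
  have hUfin : volume U ≠ ⊤ := ((measure_mono hUK).trans_lt hKc.measure_lt_top).ne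
  have hUpos : 0 < volume.real U := ENNReal.toReal_pos (hUo.measure_pos volume hUne).ne' hUfin
  have hDi : Integrable (indicatorDiff K L) :=
    Integrable.mono' (integrable_exp_neg_sq_norm.const_mul (Real.exp (R ^ 2)))
      (measurable_indicatorDiff hKc.measurableSet hLc.measurableSet).aestronglyMeasurable
      (ae_of_all _ fun x =>
        abs_indicatorDiff_le_exp (subset_union_left.trans hR) (subset_union_right.trans hR) x)
  set I : ℝ := ∫ x, |indicatorDiff K L x| with hI
  have hbound : ∀ s : ℝ, volume.real U * (R ^ 2)⁻¹ ≤
      I * (r ^ 2)⁻¹ * Real.exp (-(s ^ 2 * η / 8)) := fun s => by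
    set g : EuclideanSpace ℂ (Fin n) → ℝ := fun x => indicatorDiff K L x *
      (Real.exp (-(s ^ 2 * (‖a‖ ^ 2 - ‖inner ℂ x a‖ ^ 2 / ‖x‖ ^ 2) / 4)) * (‖x‖ ^ 2)⁻¹) with hg
    have hg0 : ∫ x, g x = 0 :=
      hK.integral_indicatorDiff_mul_kernel_eq_zero hn hL h hr hDr a s
    have hψ0 : ∀ x, 0 ≤ ‖a‖ ^ 2 - ‖inner ℂ x a‖ ^ 2 / ‖x‖ ^ 2 := fun x => by
      rcases eq_or_ne x 0 with rfl | hx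
      · simp
      · rw [← norm_orthogonalProjectionOnto_complexHyperplane_sq hx]; positivity
    have habs : ∀ x, |g x| ≤ |indicatorDiff K L x| *
        (Real.exp (-(s ^ 2 * (‖a‖ ^ 2 - ‖inner ℂ x a‖ ^ 2 / ‖x‖ ^ 2) / 4)) * (r ^ 2)⁻¹) :=
      fun x => by
      rcases lt_or_ge ‖x‖ r with hxr | hxr
      · simp [hg, hDr x hxr]
      · rw [hg]
        simp only
        rw [abs_mul, abs_of_nonneg (a := Real.exp _ * _) (by positivity)]
        gcongr
    have hgi : Integrable g := by
      refine Integrable.mono' (hDi.abs.mul_const (r ^ 2)⁻¹) ?_ (ae_of_all _ fun x => ?_)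
      · refine Measurable.aestronglyMeasurable ?_
        refine (measurable_indicatorDiff hKc.measurableSet hLc.measurableSet).mul ?_
        have : Measurable fun x : EuclideanSpace ℂ (Fin n) => ‖inner ℂ x a‖ :=
          Continuous.measurable (by fun_prop)
        fun_prop
      · refine (habs x).trans (mul_le_mul_of_nonneg_left ?_ (abs_nonneg _))
        refine mul_le_of_le_one_left (by positivity) (Real.exp_le_one_iff.2 ?_)
        have := mul_nonneg (sq_nonneg s) (hψ0 x)
        linarith
    -- Three regions: on `U` the integrand has a definite positive size, elsewhere in the cone it is
    -- nonnegative, and off the cone its absolute value is within the subtracted error.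
    have hlow : ∀ x, U.indicator (fun _ => (R ^ 2)⁻¹ * Real.exp (-(s ^ 2 * η / 8))) x -
        |indicatorDiff K L x| * ((r ^ 2)⁻¹ * Real.exp (-(s ^ 2 * η / 4))) ≤ g x := fun x => by
      rcases lt_or_ge ‖x‖ r with hxr | hxr
      · have hxU : x ∉ U := fun hx => by
          have : gauge L x ≤ 1 := gauge_le_one_of_mem (hrball (mem_ball_zero_iff.2 hxr)).2
          exact absurd hx.1.2 (not_lt.2 this)
        simp [hg, hDr x hxr, hxU]
      have hx : x ≠ 0 := norm_pos_iff.1 (hr.trans_le hxr)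
      have hx2 : 0 < ‖x‖ ^ 2 := by positivity
      have hpos : 0 ≤ |indicatorDiff K L x| * ((r ^ 2)⁻¹ * Real.exp (-(s ^ 2 * η / 4))) := by
        positivity
      by_cases hxU : x ∈ U
      · have hxL : x ∉ L := fun hx' => absurd hxU.1.2 (not_lt.2 (gauge_le_one_of_mem hx'))
        have hD1 : indicatorDiff K L x = 1 := by simp [indicatorDiff, hUK hxU, hxL]
        have hxR : ‖x‖ ≤ R := mem_closedBall_zero_iff.1 (hR (Or.inl (hUK hxU)))
        have hψ : ‖a‖ ^ 2 - ‖inner ℂ x a‖ ^ 2 / ‖x‖ ^ 2 ≤ η / 2 := by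
          have := (lt_div_iff₀ hx2).2 hxU.2
          rw [ha]; linarith
        rw [indicator_of_mem hxU]
        simp only [hg, hD1, one_mul]
        have h1 : (R ^ 2)⁻¹ ≤ (‖x‖ ^ 2)⁻¹ := by gcongr
        have h2 : Real.exp (-(s ^ 2 * η / 8)) ≤
            Real.exp (-(s ^ 2 * (‖a‖ ^ 2 - ‖inner ℂ x a‖ ^ 2 / ‖x‖ ^ 2) / 4)) := by
          rw [Real.exp_le_exp]
          nlinarith [mul_le_mul_of_nonneg_left hψ (sq_nonneg s)]
        have h3 := mul_le_mul h2 h1 (by positivity) (by positivity)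
        rw [hD1] at hpos
        linarith
      · rw [indicator_of_notMem hxU]
        by_cases hψ : 1 - ‖inner ℂ x a‖ ^ 2 / ‖x‖ ^ 2 < η
        · have hD0 : 0 ≤ indicatorDiff K L x := by
            have hKL : x ∈ L → x ∈ K := fun hxL => by
              rw [hK.isStarBody.mem_iff_gauge_le_one]
              exact (hcone x hx hψ).le.trans (gauge_le_one_of_mem hxL)
            unfold indicatorDiff
            by_cases h1 : x ∈ L
            · simp [h1, hKL h1]
            · by_cases h2 : x ∈ K <;> simp [h1, h2]
          have : 0 ≤ g x := by simp only [hg]; positivity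
          linarith
        · have h1 := (neg_abs_le (g x)).trans' (neg_le_neg (habs x))
          refine le_trans ?_ h1
          rw [zero_sub, neg_le_neg_iff, mul_comm (r ^ 2)⁻¹]
          gcongr
          rw [ha]
          nlinarith [mul_le_mul_of_nonneg_left (not_lt.1 hψ) (sq_nonneg s)]
    have hUi : Integrable (U.indicator fun _ => (R ^ 2)⁻¹ * Real.exp (-(s ^ 2 * η / 8))) :=
      (integrable_indicator_iff hUo.measurableSet).2 (integrableOn_const hUfin)
    have hint := integral_mono (hUi.sub (hDi.abs.mul_const _)) hgi hlow
    simp only [Pi.sub_apply] at hint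
    rw [integral_sub hUi (hDi.abs.mul_const _), hg0, integral_mul_const,
      integral_indicator hUo.measurableSet, setIntegral_const, smul_eq_mul, ← hI] at hint
    -- Dividing by one factor `exp (-s² η / 8)` leaves a positive constant bounded by a quantity
    -- that tends to zero as `s → ∞`.
    have hexp : Real.exp (-(s ^ 2 * η / 4)) =
        Real.exp (-(s ^ 2 * η / 8)) * Real.exp (-(s ^ 2 * η / 8)) := by
      rw [← Real.exp_add]; congr 1; ring
    rw [hexp] at hint
    have he := Real.exp_pos (-(s ^ 2 * η / 8))
    refine le_of_mul_le_mul_right ?_ he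
    linarith
  have hlim : Tendsto (fun s : ℝ => I * (r ^ 2)⁻¹ * Real.exp (-(s ^ 2 * η / 8))) atTop
      (𝓝 (I * (r ^ 2)⁻¹ * 0)) := by
    refine tendsto_const_nhds.mul (Real.tendsto_exp_neg_atTop_nhds_zero.comp ?_)
    exact ((tendsto_pow_atTop two_ne_zero).atTop_mul_const hη0).atTop_div_const (by norm_num)
  rw [mul_zero] at hlim
  have hle := ge_of_tendsto' hlim hbound
  have : 0 < volume.real U * (R ^ 2)⁻¹ := by positivity
  linarith

/-- An origin symmetric complex star body is determined by the volumes of its central complex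
hyperplane sections. -/
theorem IsSymmComplexStarBody.eq_of_sectionVolume_eq (hn : 2 ≤ n)
    (hK : IsSymmComplexStarBody K) (hL : IsSymmComplexStarBody L)
    (h : ∀ ξ : EuclideanSpace ℂ (Fin n), ‖ξ‖ = 1 →
      sectionVolume K (complexHyperplane ξ) = sectionVolume L (complexHyperplane ξ)) : K = L := by
  refine hK.isStarBody.eq_of_gauge_eq hL.isStarBody fun x => ?_
  rcases eq_or_ne x 0 with rfl | hx
  · rw [gauge_zero, gauge_zero]
  have hx0 : ‖x‖ ≠ 0 := norm_ne_zero_iff.2 hx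
  have hunit : ‖‖x‖⁻¹ • x‖ = 1 := by
    rw [norm_smul, norm_inv, norm_norm, inv_mul_cancel₀ hx0]
  have heq := le_antisymm (hL.gauge_le_of_norm_eq_one hn hK (fun ξ hξ => (h ξ hξ).symm) hunit)
    (hK.gauge_le_of_norm_eq_one hn hL h hunit)
  rw [← smul_inv_smul₀ hx0 x, gauge_smul_of_nonneg (norm_nonneg x),
    gauge_smul_of_nonneg (norm_nonneg x), heq]

end Uniqueness

/-- First part: bodies with the same complex intersection body coincide. Second part: a body is
determined by the volumes of its central complex hyperplane sections. -/
theorem mainTheorem7 (n : ℕ) (hn : 2 ≤ n) (K L : Set (EuclideanSpace ℂ (Fin n)))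
    (hK : IsSymmComplexStarBody K) (hL : IsSymmComplexStarBody L) :
    (∀ M : Set (EuclideanSpace ℂ (Fin n)),
      IsComplexIntersectionBodyOf M K → IsComplexIntersectionBodyOf M L → K = L) ∧
    ((∀ ξ : EuclideanSpace ℂ (Fin n), ‖ξ‖ = 1 →
      sectionVolume K (complexHyperplane ξ) = sectionVolume L (complexHyperplane ξ)) → K = L) :=
  ⟨fun _ hMK hML => hK.eq_of_sectionVolume_eq hn hL fun ξ hξ =>
    (hMK.volume_eq ξ hξ).symm.trans (hML.volume_eq ξ hξ), hK.eq_of_sectionVolume_eq hn hL⟩
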